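/- Let $0<\lambda\le\Lambda$, let $\tilde N_-=\frac{\Lambda}{\lambda}+1$, and let $p>1$. On the closed half-plane $\{(X,Z)\in\mathbb R^2 : Z\ge 0\}$, which contains the closed first quadrant, consider the autonomous system $$\dot X=f(X,Z),\qquad \dot Z=g(X,Z),$$ where $$f(X,Z)=\begin{cases}X\left(X+\frac{Z}{\Lambda}\right) & \text{if } Z>\Lambda,\\ X\left(X-(\tilde N_--2)+\frac{Z}{\lambda}\right) & \text{if } 0\le Z\le\Lambda,\end{cases}\qquad g(X,Z)=\begin{cases}Z\left(2-pX-\frac{Z}{\Lambda}\right) & \text{if } Z>\Lambda,\\ Z\left(\tilde N_--pX-\frac{Z}{\lambda}\right) & \text{if } 0\le Z\le\Lambda\end{cases}$$ (the two formulas agree on the line $Z=\Lambda$, so $f$ and $g$ are continuous). This is the system satisfied by $X(t)=-\frac{r u'(r)}{u(r)}$, $Z(t)=-\frac{r u(r)^p}{u'(r)}$, $t=\ln r$, when $u>0$ is a radial solution with $u'<0$ of $-\mathcal M^-_{\lambda,\Lambda}(D^2u)=u^p$ in dimension two. A periodic orbit is the trace of a nonconstant periodic solution $t\mapsto (X(t),Z(t))$,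 $t\in\mathbb R$, of the system. Then: (i) The system has no periodic orbits if $1<p<\frac{\tilde N_-+2}{\tilde N_--2}$, where the right-hand side is read as $+\infty$ when $\lambda=\Lambda$ (that is, when $\tilde N_-=2$). (ii) If $\lambda<\Lambda$, there exists $p_o>\max\left\{3,\frac{\tilde N_-+2}{\tilde N_--2}\right\}$, depending only on $\lambda$ and $\Lambda$, such that the system has no periodic orbits for any $p>p_o$. -/

import Mathlib

namespace PucciPlanar

/-- The dimension-like number `Ñ₋ = (Λ/λ)(N - 1) + 1` of the operator `M⁻` in dimension `N = 2`. -/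
noncomputable def dimMinus (lam Lam : ℝ) : ℝ := Lam / lam + 1

/-- The exponent `(Ñ₋ + 2)/(Ñ₋ - 2)`. It is meaningful for `λ < Λ`, when `Ñ₋ > 2`. -/
noncomputable def critExp (lam Lam : ℝ) : ℝ :=
  (dimMinus lam Lam + 2) / (dimMinus lam Lam - 2)

/-- First component `f` of the vector field. The first branch is `R⁺ = {Z > Λ}`, the second one
is `R⁻ = {Z < Λ}`; on the line `Z = Λ` both formulas have the value `X (X + 1)`. -/
noncomputable def fieldX (lam Lam : ℝ) (q : ℝ × ℝ) : ℝ :=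
  if Lam < q.2 then q.1 * (q.1 + q.2 / Lam)
  else q.1 * (q.1 - (dimMinus lam Lam - 2) + q.2 / lam)

/-- Second component `g` of the vector field, with the same two branches; on the line `Z = Λ`
both formulas have the value `Λ (1 - p X)`. -/
noncomputable def fieldZ (lam Lam p : ℝ) (q : ℝ × ℝ) : ℝ :=
  if Lam < q.2 then q.2 * (2 - p * q.1 - q.2 / Lam)
  else q.2 * (dimMinus lam Lam - p * q.1 - q.2 / lam)

/-- The continuous vector field `F = (f, g)`. -/
noncomputable def field (lam Lam p : ℝ) (q : ℝ × ℝ) : ℝ × ℝ :=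
  (fieldX lam Lam q, fieldZ lam Lam p q)

/-- The phase space: the closed upper half-plane `Z ≥ 0`, which consists of `R⁺`, the line `Z = Λ`,
`R⁻` and the invariant line `Z = 0`. It contains the closed first quadrant. -/
def phaseSpace : Set (ℝ × ℝ) := {q | 0 ≤ q.2}

/-- `γ` is a global solution of `(Ẋ, Ż) = F(X, Z)` in the phase space. -/
def IsSolution (lam Lam p : ℝ) (γ : ℝ → ℝ × ℝ) : Prop :=
  ∀ t : ℝ, γ t ∈ phaseSpace ∧ HasDerivAt γ (field lam Lam p (γ t)) t

/-- `S` is a periodic orbit: the trace of a nonconstant periodic solution. -/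
def IsPeriodicOrbit (lam Lam p : ℝ) (S : Set (ℝ × ℝ)) : Prop :=
  ∃ γ : ℝ → ℝ × ℝ, IsSolution lam Lam p γ ∧ (∃ T : ℝ, 0 < T ∧ Function.Periodic γ T) ∧
    (∃ s t : ℝ, γ s ≠ γ t) ∧ S = Set.range γ

end PucciPlanar

/-! Put k = Λ/λ - 1, α = 2/(p - 1), x = X/α, s = XZ/(Λα). In the open quadrant the system becomes x'
= αx² + s - k(x - s)⁺, s' = 2s(1 - x). Periodic solutions on the axes or with X < 0 are excluded
directly (`eq_of_periodic`). The trace of a nonconstant periodic solution makes turns about x = 1: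
an arc in x > 1 along which s falls, then one in x < 1 along which s rises. Both are graphs over the
s-axis, U and L, issuing from the same lowest point.

Compare them through `gap`, s^α((L - 1)² - (U - 1)²), which vanishes at that point. The weight s^α
cancels the quadratic terms and leaves the derivative s^(α-1)(2α(U - L) - k((U - s)⁺ - (L - s)⁺)).

For (i), p below the critical exponent means k < 2α, so the gap strictly increases (`gapRate_pos`).
On the turn that starts at the maximum of s, the lower arc ends no higher than the upper one, and
there the gap is at most 0: a contradiction.

For (ii), large p makes α tiny compared with k. On the turn that ends at the maximum of s, the upper
arc ends no higher than the lower one, and there the gap is at least 0; `IsLowerArc.gap_neg` shows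
that it is negative. Lower arcs never pass s = 1 (`right_le_one`), and the gap decreases as long as
s ≤ 1 - δ. If the turn goes further, `barrier` keeps L ≤ 1/2 for s in (1/4, 1/2); the resulting
loss, at least k/16, exceeds the later gain, at most 2α. -/

namespace PucciPlanar

open Set Filter Topology

/-! ### Calculus on the line -/

/-- A function whose derivative is positive inside an interval has a continuous inverse there, which
is differentiable inside. -/
theorem exists_inverse_of_hasDerivAt_pos {y c : ℝ → ℝ} {a b : ℝ} (hab : a < b)
    (hy : ∀ t ∈ Icc a b, HasDerivAt y (c t) t) (hc : ∀ t ∈ Ioo a b, 0 < c t) :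
    y a < y b ∧ ∃ τ : ℝ → ℝ, Continuous τ ∧ τ (y a) = a ∧ τ (y b) = b ∧
      (∀ s, τ s ∈ Icc a b) ∧
      ∀ s ∈ Ioo (y a) (y b), τ s ∈ Ioo a b ∧ y (τ s) = s ∧ HasDerivAt τ (c (τ s))⁻¹ s := by
  have hcont : ContinuousOn y (Icc a b) := fun t ht => (hy t ht).continuousAt.continuousWithinAt
  have hmono : StrictMonoOn y (Icc a b) := by
    refine strictMonoOn_of_deriv_pos (convex_Icc a b) hcont fun t ht => ?_
    rw [interior_Icc] at ht
    rw [(hy t (Ioo_subset_Icc_self ht)).deriv]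
    exact hc t ht
  have ha : a ∈ Icc a b := left_mem_Icc.2 hab.le
  have hb : b ∈ Icc a b := right_mem_Icc.2 hab.le
  have hyab : y a < y b := hmono ha hb hab
  have hmaps : MapsTo y (Icc a b) (Icc (y a) (y b)) := fun t ht =>
    ⟨hmono.monotoneOn ha ht ht.1, hmono.monotoneOn ht hb ht.2⟩
  have hbij : Function.Bijective (hmaps.restrict y (Icc a b) (Icc (y a) (y b))) := by
    refine ⟨fun s t hst => Subtype.ext (hmono.injOn s.2 t.2 (congrArg Subtype.val hst)), ?_⟩
    rintro ⟨s, hs⟩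
    obtain ⟨t, ht, rfl⟩ := intermediate_value_Icc hab.le hcont hs
    exact ⟨⟨t, ht⟩, rfl⟩
  let e := Equiv.ofBijective _ hbij
  have he : Continuous e := hcont.mapsToRestrict hmaps
  let φ := he.homeoOfEquivCompactToT2
  let τ : ℝ → ℝ := fun s => (φ.symm (projIcc (y a) (y b) hyab.le s) : ℝ)
  have hτc : Continuous τ :=
    continuous_subtype_val.comp (φ.symm.continuous.comp continuous_projIcc)
  have hleft : ∀ t ∈ Icc a b, τ (y t) = t := by
    intro t ht
    have h1 : φ ⟨t, ht⟩ = projIcc (y a) (y b) hyab.le (y t) := by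
      rw [projIcc_of_mem hyab.le (hmaps ht)]; rfl
    simp only [τ, ← h1, Homeomorph.symm_apply_apply]
  have hright : ∀ s ∈ Icc (y a) (y b), y (τ s) = s := by
    intro s hs
    obtain ⟨t, ht, rfl⟩ := intermediate_value_Icc hab.le hcont hs
    rw [hleft t ht]
  refine ⟨hyab, τ, hτc, hleft a ha, hleft b hb, fun s => (φ.symm _).2, fun s hs => ?_⟩
  have hs' := hright s (Ioo_subset_Icc_self hs)
  have hmem : τ s ∈ Icc a b := (φ.symm _).2
  have hin : τ s ∈ Ioo a b := by
    refine ⟨lt_of_le_of_ne hmem.1 fun h => ?_, lt_of_le_of_ne hmem.2 fun h => ?_⟩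
    · rw [← h] at hs'; exact hs.1.ne hs'
    · rw [h] at hs'; exact hs.2.ne' hs'
  refine ⟨hin, hs', HasDerivAt.of_local_left_inverse hτc.continuousAt (hy _ hmem) (hc _ hin).ne' ?_⟩
  filter_upwards [Ioo_mem_nhds hs.1 hs.2] with r hr using hright r (Ioo_subset_Icc_self hr)

/-- The sign of a function on both sides of a zero with positive derivative. -/
theorem exists_sign_of_hasDerivAt_pos {f : ℝ → ℝ} {d a : ℝ} (hf : HasDerivAt f d a)
    (hd : 0 < d) (ha : f a = 0) :
    ∃ ε > 0, (∀ t ∈ Ioo a (a + ε), 0 < f t) ∧ ∀ t ∈ Ioo (a - ε) a, f t < 0 := by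
  have h := eventually_nhdsWithin_sign_eq_of_deriv_pos (f := f) (x₀ := a) (by rwa [hf.deriv]) ha
  obtain ⟨ε, hε, h⟩ := Metric.eventually_nhds_iff.1 h
  refine ⟨ε, hε, fun t ht => ?_, fun t ht => ?_⟩
  · have h1 := h (y := t) (by rw [Real.dist_eq, abs_lt]; constructor <;> linarith [ht.1, ht.2])
    rw [sign_pos (sub_pos.2 ht.1)] at h1
    exact sign_eq_one_iff.1 h1
  · have h1 := h (y := t) (by rw [Real.dist_eq, abs_lt]; constructor <;> linarith [ht.1, ht.2])
    rw [sign_neg (sub_neg.2 ht.2)] at h1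
    exact sign_eq_neg_one_iff.1 h1

theorem deriv_nonpos_of_pos_left {f : ℝ → ℝ} {d a b : ℝ} (hab : a < b) (hf : HasDerivAt f d b)
    (hb : f b = 0) (hpos : ∀ t ∈ Ioo a b, 0 < f t) : d ≤ 0 := by
  by_contra! hd
  obtain ⟨ε, hε, -, h⟩ := exists_sign_of_hasDerivAt_pos hf hd hb
  obtain ⟨t, ht1, ht2⟩ := exists_between (max_lt hab (sub_lt_self b hε))
  exact lt_asymm (hpos t ⟨(le_max_left _ _).trans_lt ht1, ht2⟩)
    (h t ⟨(le_max_right _ _).trans_lt ht1, ht2⟩)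

theorem deriv_nonneg_of_pos_right {f : ℝ → ℝ} {d a b : ℝ} (hab : a < b) (hf : HasDerivAt f d a)
    (ha : f a = 0) (hpos : ∀ t ∈ Ioo a b, 0 < f t) : 0 ≤ d := by
  by_contra! hd
  obtain ⟨ε, hε, h, -⟩ := exists_sign_of_hasDerivAt_pos hf.neg (neg_pos.2 hd) (by simp [ha])
  obtain ⟨t, ht1, ht2⟩ := exists_between (lt_min hab (lt_add_of_pos_right a hε))
  have h1 := h t ⟨ht1, ht2.trans_le (min_le_right _ _)⟩
  have h2 := hpos t ⟨ht1, ht2.trans_le (min_le_left _ _)⟩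
  simp only [Pi.neg_apply] at h1
  linarith

/-- The zero is the first nonpositive point after `a`; the positive derivative keeps it away from
`a`. In the applications `c` is `a` shifted by a period. -/
theorem exists_next_zero {f : ℝ → ℝ} {d a c : ℝ} (hcont : Continuous f) (hf : HasDerivAt f d a)
    (hd : 0 < d) (ha : f a = 0) (hac : a < c) (hc : f c ≤ 0) :
    ∃ b, a < b ∧ f b = 0 ∧ ∀ t ∈ Ioo a b, 0 < f t := by
  obtain ⟨ε, hε, hpos, -⟩ := exists_sign_of_hasDerivAt_pos hf hd ha
  obtain ⟨e, he1, he2⟩ := exists_between (lt_min hac (lt_add_of_pos_right a hε))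
  have hec : e < c := he2.trans_le (min_le_left _ _)
  have heε : e < a + ε := he2.trans_le (min_le_right _ _)
  have hK : IsCompact (Icc e c ∩ f ⁻¹' Iic 0) := isCompact_Icc.inter_right (isClosed_Iic.preimage hcont)
  obtain ⟨b, ⟨hb1, hb2⟩, hleast⟩ := hK.exists_isLeast ⟨c, right_mem_Icc.2 hec.le, hc⟩
  have hfe : 0 < f e := hpos e ⟨he1, heε⟩
  have hbefore : ∀ t ∈ Ioo a b, 0 < f t := by
    intro t ht
    by_contra! h
    rcases le_or_gt e t with het | het
    · exact ht.2.not_ge (hleast ⟨⟨het, ht.2.le.trans hb1.2⟩, h⟩)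
    · exact h.not_gt (hpos t ⟨ht.1, het.trans heε⟩)
  refine ⟨b, he1.trans_le hb1.1, le_antisymm hb2 ?_, hbefore⟩
  have heb : e < b := lt_of_le_of_ne hb1.1 fun h => by rw [← h] at hb2; exact hfe.not_ge hb2
  refine ge_of_tendsto (hcont.tendsto b |>.mono_left nhdsWithin_le_nhds : Tendsto f (𝓝[<] b) _) ?_
  filter_upwards [Ioo_mem_nhdsLT heb] with t ht using (hbefore t ⟨he1.trans ht.1, ht.2⟩).le

theorem exists_prev_zero {f : ℝ → ℝ} {d a c : ℝ} (hcont : Continuous f) (hf : HasDerivAt f d a)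
    (hd : 0 < d) (ha : f a = 0) (hca : c < a) (hc : 0 ≤ f c) :
    ∃ b, b < a ∧ f b = 0 ∧ ∀ t ∈ Ioo b a, f t < 0 := by
  have hg : HasDerivAt (fun t => -f (-t)) d (-a) := by
    have hf' : HasDerivAt f d (-(-a)) := by rwa [neg_neg]
    exact (hf'.comp (-a) (hasDerivAt_neg (-a))).neg.congr_deriv (by ring)
  obtain ⟨b, hb1, hb2, hb3⟩ := exists_next_zero (f := fun t => -f (-t)) (c := -c) (by fun_prop) hg hd
    (by simp [ha]) (neg_lt_neg hca) (by simpa using hc)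
  refine ⟨-b, by linarith, by simpa using hb2, fun t ht => ?_⟩
  simpa using hb3 (-t) ⟨by linarith [ht.2], by linarith [ht.1]⟩

/-- A function which is decreasing wherever it vanishes and positive at the right end of an
interval is nonnegative on the interval. -/
theorem nonneg_of_deriv_neg_of_zero {f : ℝ → ℝ} {a b : ℝ} (hcont : ContinuousOn f (Icc a b))
    (hb : 0 < f b) (hf : ∀ x ∈ Ioo a b, f x = 0 → ∃ d < 0, HasDerivAt f d x) :
    ∀ x ∈ Icc a b, 0 ≤ f x := by
  intro c hc
  by_contra! hneg
  have hcont' : ContinuousOn f (Icc c b) := hcont.mono (Icc_subset_Icc_left hc.1)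
  have hK : IsCompact (Icc c b ∩ f ⁻¹' Iic 0) :=
    isCompact_Icc.of_isClosed_subset (hcont'.preimage_isClosed_of_isClosed isClosed_Icc isClosed_Iic)
      inter_subset_left
  -- The last nonpositive point is a zero followed by positive values, which is incompatible with a
  -- negative derivative.
  obtain ⟨z, ⟨hz1, hz2⟩, hgreat⟩ := hK.exists_isGreatest ⟨c, left_mem_Icc.2 hc.2, hneg.le⟩
  have hzb : z < b := lt_of_le_of_ne hz1.2 fun h => by rw [h] at hz2; exact hb.not_ge hz2
  have hz0 : f z = 0 := by
    by_contra hne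
    have hlt : f z < 0 := lt_of_le_of_ne hz2 hne
    obtain ⟨y, hy, hy0⟩ := intermediate_value_Ioo hzb.le (hcont'.mono (Icc_subset_Icc_left hz1.1))
      ⟨hlt, hb⟩
    exact hy.1.not_ge (hgreat ⟨⟨hz1.1.trans hy.1.le, hy.2.le⟩, hy0.le⟩)
  have hcz : c < z := lt_of_le_of_ne hz1.1 fun h => by rw [h] at hneg; exact hneg.ne hz0
  obtain ⟨d, hd, hder⟩ := hf z ⟨hc.1.trans_lt hcz, hzb⟩ hz0
  refine (deriv_nonneg_of_pos_right hzb hder hz0 fun t ht => ?_).not_gt hd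
  by_contra! h
  exact ht.1.not_ge (hgreat ⟨⟨hz1.1.trans ht.1.le, ht.2.le⟩, h⟩)

/-- A function which is increasing wherever it vanishes and positive at the left end of an
interval is nonnegative on the interval. -/
theorem nonneg_of_deriv_pos_of_zero {f : ℝ → ℝ} {a b : ℝ} (hcont : ContinuousOn f (Icc a b))
    (ha : 0 < f a) (hf : ∀ x ∈ Ioo a b, f x = 0 → ∃ d > 0, HasDerivAt f d x) :
    ∀ x ∈ Icc a b, 0 ≤ f x := by
  have hmaps : MapsTo (fun x : ℝ => -x) (Icc (-b) (-a)) (Icc a b) := fun x hx =>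
    ⟨by linarith [hx.2], by linarith [hx.1]⟩
  have h := nonneg_of_deriv_neg_of_zero (f := fun x => f (-x)) (a := -b) (b := -a)
    (hcont.comp continuousOn_neg hmaps) (by simpa using ha) (fun x hx h0 => by
      obtain ⟨d, hd, hder⟩ := hf (-x) ⟨by linarith [hx.2], by linarith [hx.1]⟩ h0
      refine ⟨-d, neg_neg_of_pos hd, ?_⟩
      exact (hder.comp x (hasDerivAt_neg x)).congr_deriv (by ring))
  intro x hx
  simpa using h (-x) ⟨by linarith [hx.2], by linarith [hx.1]⟩

/-- A solution of a scalar linear homogeneous equation which vanishes once vanishes identically. -/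
theorem eq_zero_of_hasDerivAt_mul {u h : ℝ → ℝ} (hh : Continuous h)
    (hu : ∀ t, HasDerivAt u (u t * h t) t) {t₀ : ℝ} (h0 : u t₀ = 0) : ∀ t, u t = 0 := by
  have hI : ∀ t, HasDerivAt (fun t => ∫ r in t₀..t, h r) (h t) t := fun t =>
    hh.integral_hasStrictDerivAt t₀ t |>.hasDerivAt
  have hw : ∀ t, HasDerivAt (fun t => u t * Real.exp (-∫ r in t₀..t, h r)) 0 t := by
    intro t
    refine ((hu t).mul (hI t).neg.exp).congr_deriv ?_
    simp only [Pi.neg_apply]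
    ring
  intro t
  have h1 := is_const_of_deriv_eq_zero (fun t => (hw t).differentiableAt)
    (fun t => (hw t).deriv) t t₀
  simp only [h0, zero_mul] at h1
  exact (mul_eq_zero.1 h1).resolve_right (Real.exp_pos _).ne'

theorem exists_forall_le_of_periodic {f : ℝ → ℝ} {T : ℝ} (hT : 0 < T) (hp : Function.Periodic f T)
    (hcont : Continuous f) : ∃ t₀, ∀ t, f t ≤ f t₀ := by
  obtain ⟨_, ⟨⟨t₀, rfl⟩, h⟩⟩ := (hp.compact_of_continuous hT.ne' hcont).exists_isGreatest
    (range_nonempty f)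
  exact ⟨t₀, fun t => h ⟨t, rfl⟩⟩

theorem exists_forall_ge_of_periodic {f : ℝ → ℝ} {T : ℝ} (hT : 0 < T) (hp : Function.Periodic f T)
    (hcont : Continuous f) : ∃ t₀, ∀ t, f t₀ ≤ f t := by
  obtain ⟨_, ⟨⟨t₀, rfl⟩, h⟩⟩ := (hp.compact_of_continuous hT.ne' hcont).exists_isLeast
    (range_nonempty f)
  exact ⟨t₀, fun t => h ⟨t, rfl⟩⟩

/-! ### The normalized system -/

/-- The first component of the normalized vector field. -/
noncomputable def drift (α k s x : ℝ) : ℝ := α * x ^ 2 + s - k * max (x - s) 0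

/-- A global solution in the open quadrant of `x' = α x² + s - k (x - s)⁺`, `s' = 2 s (1 - x)`. -/
structure IsNormSol (α k : ℝ) (x s : ℝ → ℝ) : Prop where
  x_pos : ∀ t, 0 < x t
  s_pos : ∀ t, 0 < s t
  hasDerivAt_x : ∀ t, HasDerivAt x (drift α k (s t) (x t)) t
  hasDerivAt_s : ∀ t, HasDerivAt s (2 * s t * (1 - x t)) t

namespace IsNormSol

variable {α k T : ℝ} {x s : ℝ → ℝ}

theorem continuous_x (h : IsNormSol α k x s) : Continuous x :=
  continuous_iff_continuousAt.2 fun t => (h.hasDerivAt_x t).continuousAt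

theorem continuous_s (h : IsNormSol α k x s) : Continuous s :=
  continuous_iff_continuousAt.2 fun t => (h.hasDerivAt_s t).continuousAt

end IsNormSol

/-- The positive part is not differentiable, but Lipschitz regularity suffices for uniqueness at an
equilibrium. -/
theorem locallyLipschitz_normField (α k : ℝ) :
    LocallyLipschitz fun q : ℝ × ℝ => (drift α k q.2 q.1, 2 * q.2 * (1 - q.1)) := by
  have h0 : ContDiff ℝ 1 fun q : ℝ × ℝ => q.1 - q.2 := by fun_prop
  have h1 : LocallyLipschitz fun q : ℝ × ℝ => max (q.1 - q.2) 0 := h0.locallyLipschitz.max_const 0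
  have h2 : ContDiff ℝ 1 fun q : (ℝ × ℝ) × ℝ =>
      (α * q.1.1 ^ 2 + q.1.2 - k * q.2, 2 * q.1.2 * (1 - q.1.1)) := by fun_prop
  have h3 := h2.locallyLipschitz.comp (LocallyLipschitz.id.prodMk h1)
  exact h3

namespace IsNormSol

variable {α k T : ℝ} {x s : ℝ → ℝ}

/-- A periodic solution through an equilibrium is constant. -/
theorem eq_of_equilibrium (h : IsNormSol α k x s) (hT : 0 < T) (hx : Function.Periodic x T)
    (hs : Function.Periodic s T) {t₀ : ℝ} (hx0 : x t₀ = 1) (h0 : drift α k (s t₀) 1 = 0) (t : ℝ) :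
    x t = x t₀ ∧ s t = s t₀ := by
  have hcont : Continuous fun t => (x t, s t) := h.continuous_x.prodMk h.continuous_s
  have hper : Function.Periodic (fun t => (x t, s t)) T := fun t => by
    simp only [hx t, hs t]
  obtain ⟨K, hK⟩ := LocallyLipschitzOn.exists_lipschitzOnWith_of_compact
    (hper.compact_of_continuous hT.ne' hcont) (locallyLipschitz_normField α k).locallyLipschitzOn
  have heq := ODE_solution_unique_univ (E := ℝ × ℝ)
    (v := fun _ q => (drift α k q.2 q.1, 2 * q.2 * (1 - q.1)))
    (s := fun _ => range fun t => (x t, s t)) (f := fun t => (x t, s t))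
    (g := fun _ => (x t₀, s t₀)) (t₀ := t₀) (fun _ => hK)
    (fun t => ⟨(h.hasDerivAt_x t).prodMk (h.hasDerivAt_s t), t, rfl⟩)
    (fun t => ⟨(hasDerivAt_const t (x t₀, s t₀)).congr_deriv (by simp only [hx0, h0, sub_self, mul_zero]; rfl), t₀, rfl⟩) rfl
  exact Prod.ext_iff.1 (congrFun heq t)

end IsNormSol

/-- Three consecutive times at which `x = 1`. -/
structure IsTurn (α k : ℝ) (x s : ℝ → ℝ) (t₁ t₂ t₃ : ℝ) : Prop where
  lt₁₂ : t₁ < t₂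
  lt₂₃ : t₂ < t₃
  x₁ : x t₁ = 1
  x₂ : x t₂ = 1
  x₃ : x t₃ = 1
  one_lt : ∀ t ∈ Ioo t₁ t₂, 1 < x t
  lt_one : ∀ t ∈ Ioo t₂ t₃, x t < 1
  drift_neg : drift α k (s t₂) 1 < 0

/-! ### Turns of a periodic solution about the line x = 1 -/

namespace IsNormSol

variable {α k T : ℝ} {x s : ℝ → ℝ}

/-- At a maximum of `s` a nonconstant periodic solution crosses `x = 1` upwards. -/
theorem drift_pos_of_max (h : IsNormSol α k x s) (hT : 0 < T) (hx : Function.Periodic x T)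
    (hs : Function.Periodic s T) (hne : ∃ t t', (x t, s t) ≠ (x t', s t')) {t₀ : ℝ}
    (hmax : ∀ t, s t ≤ s t₀) : x t₀ = 1 ∧ 0 < drift α k (s t₀) 1 := by
  have hx0 : x t₀ = 1 := by
    have h1 := IsLocalMax.hasDerivAt_eq_zero (Eventually.of_forall hmax) (h.hasDerivAt_s t₀)
    have h2 := h.s_pos t₀
    have h3 : 1 - x t₀ = 0 := (mul_eq_zero.1 h1).resolve_left (by positivity)
    linarith
  refine ⟨hx0, lt_of_le_of_ne ?_ fun h0 => ?_⟩
  -- With a negative drift, x < 1 just after `t₀`, so s would rise above its maximum.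
  · by_contra! hneg
    have hd : HasDerivAt (fun t => 1 - x t) (-drift α k (s t₀) 1) t₀ := by
      simpa [hx0] using (h.hasDerivAt_x t₀).const_sub 1
    obtain ⟨b, hb, -, hlt⟩ := exists_next_zero (c := t₀ + T)
      (continuous_const.sub h.continuous_x) hd (by linarith) (by simp [hx0]) (by linarith)
      (by simp [hx t₀, hx0])
    have hmono : StrictMonoOn s (Icc t₀ b) := by
      refine strictMonoOn_of_deriv_pos (convex_Icc _ _) h.continuous_s.continuousOn fun t ht => ?_
      rw [interior_Icc] at ht
      rw [(h.hasDerivAt_s t).deriv]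
      have := h.s_pos t
      have := hlt t ht
      positivity
    exact (hmax b).not_gt (hmono (left_mem_Icc.2 hb.le) (right_mem_Icc.2 hb.le) hb)
  · obtain ⟨t, t', hne⟩ := hne
    have h1 := h.eq_of_equilibrium hT hx hs hx0 h0.symm
    exact hne (by rw [(h1 t).1, (h1 t).2, (h1 t').1, (h1 t').2])

theorem drift_neg_of_le (h : IsNormSol α k x s) (hT : 0 < T) (hx : Function.Periodic x T)
    (hs : Function.Periodic s T) (hne : ∃ t t', (x t, s t) ≠ (x t', s t')) {t₀ : ℝ}
    (hx0 : x t₀ = 1) (hle : drift α k (s t₀) 1 ≤ 0) : drift α k (s t₀) 1 < 0 := by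
  refine lt_of_le_of_ne hle fun h0 => ?_
  obtain ⟨t, t', hne⟩ := hne
  have h1 := h.eq_of_equilibrium hT hx hs hx0 h0
  exact hne (by rw [(h1 t).1, (h1 t).2, (h1 t').1, (h1 t').2])

/-- The turn which follows a maximum of `s`. -/
theorem exists_isTurn_after_max (h : IsNormSol α k x s) (hT : 0 < T) (hx : Function.Periodic x T)
    (hs : Function.Periodic s T) (hne : ∃ t t', (x t, s t) ≠ (x t', s t')) :
    ∃ t₁ t₂ t₃, IsTurn α k x s t₁ t₂ t₃ ∧ ∀ t, s t ≤ s t₁ := by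
  obtain ⟨t₁, hmax⟩ := exists_forall_le_of_periodic hT hs h.continuous_s
  obtain ⟨hx1, hd1⟩ := h.drift_pos_of_max hT hx hs hne hmax
  have hder : ∀ t, x t = 1 → HasDerivAt (fun t => x t - 1) (drift α k (s t) 1) t := fun t ht => by
    simpa [ht] using (h.hasDerivAt_x t).sub_const 1
  obtain ⟨t₂, h12, hx2, hlt⟩ := exists_next_zero (f := fun t => x t - 1) (c := t₁ + T)
    (h.continuous_x.sub continuous_const) (hder t₁ hx1) hd1 (by simp [hx1]) (by linarith)
    (by simp [hx t₁, hx1])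
  have hx2' : x t₂ = 1 := by linarith
  have hd2 := h.drift_neg_of_le hT hx hs hne hx2'
    (deriv_nonpos_of_pos_left h12 (hder t₂ hx2') hx2 hlt)
  obtain ⟨t₃, h23, hx3, hlt3⟩ := exists_next_zero (f := fun t => -(x t - 1)) (c := t₂ + T)
    (h.continuous_x.sub continuous_const).neg (hder t₂ hx2').neg (by linarith) (by simp [hx2'])
    (by linarith) (by simp [hx t₂, hx2'])
  exact ⟨t₁, t₂, t₃, ⟨h12, h23, hx1, hx2', by linarith, fun t ht => by linarith [hlt t ht],
    fun t ht => by linarith [hlt3 t ht], hd2⟩, hmax⟩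

/-- The turn which precedes a maximum of `s`. -/
theorem exists_isTurn_before_max (h : IsNormSol α k x s) (hT : 0 < T) (hx : Function.Periodic x T)
    (hs : Function.Periodic s T) (hne : ∃ t t', (x t, s t) ≠ (x t', s t')) :
    ∃ t₁ t₂ t₃, IsTurn α k x s t₁ t₂ t₃ ∧ ∀ t, s t ≤ s t₃ := by
  obtain ⟨t₃, hmax⟩ := exists_forall_le_of_periodic hT hs h.continuous_s
  obtain ⟨hx3, hd3⟩ := h.drift_pos_of_max hT hx hs hne hmax
  have hder : ∀ t, x t = 1 → HasDerivAt (fun t => x t - 1) (drift α k (s t) 1) t := fun t ht => by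
    simpa [ht] using (h.hasDerivAt_x t).sub_const 1
  have hprev : ∀ t, x (t - T) = x t := hx.sub_eq
  obtain ⟨t₂, h23, hx2, hlt⟩ := exists_prev_zero (f := fun t => x t - 1) (c := t₃ - T)
    (h.continuous_x.sub continuous_const) (hder t₃ hx3) hd3 (by simp [hx3]) (by linarith)
    (by simp [hprev, hx3])
  have hx2' : x t₂ = 1 := by linarith
  have hd2 := h.drift_neg_of_le hT hx hs hne hx2' (by
    have := deriv_nonneg_of_pos_right h23 (hder t₂ hx2').neg (by simp [hx2'])
      (fun t ht => by simpa using hlt t ht)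
    linarith)
  obtain ⟨t₁, h12, hx1, hlt1⟩ := exists_prev_zero (f := fun t => -(x t - 1)) (c := t₂ - T)
    (h.continuous_x.sub continuous_const).neg (hder t₂ hx2').neg (by linarith) (by simp [hx2'])
    (by linarith) (by simp [hprev, hx2'])
  exact ⟨t₁, t₂, t₃, ⟨h12, h23, by linarith, hx2', hx3, fun t ht => by linarith [hlt1 t ht],
    fun t ht => by linarith [hlt t ht], hd2⟩, hmax⟩

/-- The arc of a turn in `x < 1` is a graph over the `s`-axis. -/
theorem exists_lower_graph (h : IsNormSol α k x s) {t₁ t₂ t₃ : ℝ} (ht : IsTurn α k x s t₁ t₂ t₃) :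
    s t₂ < s t₃ ∧ ∃ ξ : ℝ → ℝ, Continuous ξ ∧ ξ (s t₂) = 1 ∧ ξ (s t₃) = 1 ∧
      ∀ r ∈ Ioo (s t₂) (s t₃), 0 < ξ r ∧ ξ r < 1 ∧
        HasDerivAt ξ (drift α k r (ξ r) / (2 * r * (1 - ξ r))) r := by
  obtain ⟨hlt, τ, hτ, hτ2, hτ3, -, hin⟩ := exists_inverse_of_hasDerivAt_pos ht.lt₂₃
    (fun t _ => h.hasDerivAt_s t) (fun t hI => by
      have := h.s_pos t
      have := ht.lt_one t hI
      have : 0 < 1 - x t := by linarith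
      positivity)
  refine ⟨hlt, fun r => x (τ r), h.continuous_x.comp hτ, by simp [hτ2, ht.x₂],
    by simp [hτ3, ht.x₃], fun r hr => ?_⟩
  obtain ⟨h1, h2, h3⟩ := hin r hr
  refine ⟨h.x_pos _, ht.lt_one _ h1, ?_⟩
  have h4 := (h.hasDerivAt_x (τ r)).comp r h3
  rw [h2] at h4
  exact h4.congr_deriv (by rw [div_eq_mul_inv])

/-- The arc of a turn in `x > 1` is a graph over the `s`-axis. -/
theorem exists_upper_graph (h : IsNormSol α k x s) {t₁ t₂ t₃ : ℝ} (ht : IsTurn α k x s t₁ t₂ t₃) :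
    s t₂ < s t₁ ∧ ∃ ξ : ℝ → ℝ, Continuous ξ ∧ ξ (s t₂) = 1 ∧ ξ (s t₁) = 1 ∧
      ∀ r ∈ Ioo (s t₂) (s t₁), 1 < ξ r ∧
        HasDerivAt ξ (drift α k r (ξ r) / (2 * r * (1 - ξ r))) r := by
  obtain ⟨hlt, τ, hτ, hτ2, hτ1, -, hin⟩ := exists_inverse_of_hasDerivAt_pos
    (y := fun t => s (-t)) (c := fun t => 2 * s (-t) * (x (-t) - 1)) (neg_lt_neg ht.lt₁₂)
    (fun t _ => by
      have := (h.hasDerivAt_s (-t)).comp t (hasDerivAt_neg t)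
      exact this.congr_deriv (by ring))
    (fun t hI => by
      have := h.s_pos (-t)
      have := ht.one_lt (-t) ⟨by linarith [hI.2], by linarith [hI.1]⟩
      have : 0 < x (-t) - 1 := by linarith
      positivity)
  simp only [neg_neg] at hlt hτ2 hτ1 hin
  refine ⟨hlt, fun r => x (-τ r), h.continuous_x.comp hτ.neg, by simp [hτ2, ht.x₂],
    by simp [hτ1, ht.x₁], fun r hr => ?_⟩
  obtain ⟨h1, h2, h3⟩ := hin r hr
  refine ⟨ht.one_lt _ ⟨by linarith [h1.2], by linarith [h1.1]⟩, ?_⟩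
  have h4 := (h.hasDerivAt_x (-τ r)).comp r h3.neg
  rw [h2] at h4
  refine h4.congr_deriv ?_
  rw [← neg_sub (x (-τ r)) 1, div_eq_mul_inv, mul_neg (2 * r), inv_neg]

end IsNormSol

/-! ### Comparison of the two arcs of a turn -/

/-- `ξ` solves, at `r`, the equation `dx/ds = x' / s'` of the trajectories. -/
def IsTrajAt (α k : ℝ) (ξ : ℝ → ℝ) (r : ℝ) : Prop :=
  HasDerivAt ξ (drift α k r (ξ r) / (2 * r * (1 - ξ r))) r

/-- Squaring the distance to x = 1 cancels the factor 1 - x of s', which is singular at the ends of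
the arcs. -/
theorem IsTrajAt.hasDerivAt_sq {α k r : ℝ} {ξ : ℝ → ℝ} (h : IsTrajAt α k ξ r) (hr : 0 < r)
    (hξ : ξ r ≠ 1) : HasDerivAt (fun r => (ξ r - 1) ^ 2) (-(drift α k r (ξ r) / r)) r := by
  have h1 : 1 - ξ r ≠ 0 := sub_ne_zero.2 hξ.symm
  refine ((HasDerivAt.sub_const 1 h).pow 2).congr_deriv ?_
  field_simp
  ring

/-- The weighted difference of the squared distances of two arcs to the line `x = 1`. -/
noncomputable def gap (α : ℝ) (L U : ℝ → ℝ) (r : ℝ) : ℝ :=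
  r ^ α * ((L r - 1) ^ 2 - (U r - 1) ^ 2)

/-- The derivative of `gap`, up to the factor `r ^ (α - 1)`. -/
noncomputable def gapRate (α k r l u : ℝ) : ℝ :=
  2 * α * (u - l) - k * (max (u - r) 0 - max (l - r) 0)

theorem hasDerivAt_gap {α k r : ℝ} {L U : ℝ → ℝ} (hL : IsTrajAt α k L r) (hU : IsTrajAt α k U r)
    (hr : 0 < r) (hL1 : L r ≠ 1) (hU1 : U r ≠ 1) :
    HasDerivAt (gap α L U) (r ^ (α - 1) * gapRate α k r (L r) (U r)) r := by
  have h1 := (Real.hasDerivAt_rpow_const (p := α) (Or.inl hr.ne')).mul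
    ((hL.hasDerivAt_sq hr hL1).sub (hU.hasDerivAt_sq hr hU1))
  refine h1.congr_deriv ?_
  have h2 : r ^ α = r ^ (α - 1) * r := by
    rw [← Real.rpow_add_one hr.ne', sub_add_cancel]
  simp only [Pi.sub_apply, h2, gapRate, drift]
  field_simp
  ring

theorem continuousOn_gap {α a b : ℝ} {L U : ℝ → ℝ} (hL : Continuous L) (hU : Continuous U)
    (ha : 0 < a) : ContinuousOn (gap α L U) (Icc a b) := by
  refine ContinuousOn.mul (fun r hr => ?_) (by fun_prop)
  exact (Real.continuousAt_rpow_const r α (Or.inl (ha.trans_le hr.1).ne')).continuousWithinAt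

/-- The positive part is 1-Lipschitz, so the damping removes at most k(u - l) from 2α(u - l). -/
theorem gapRate_pos {α k r l u : ℝ} (hk : 0 ≤ k) (hα : k < 2 * α) (hlu : l < u) :
    0 < gapRate α k r l u := by
  have h1 : max (u - r) 0 - max (l - r) 0 ≤ u - l := by
    rcases max_cases (u - r) 0 with h | h <;> rcases max_cases (l - r) 0 with h' | h' <;> linarith
  have h2 := mul_le_mul_of_nonneg_left h1 hk
  have h3 := mul_lt_mul_of_pos_right hα (sub_pos.2 hlu)
  unfold gapRate
  linarith

/-- When the damping is weak the system has no nonconstant periodic solution. -/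
theorem IsNormSol.eq_of_periodic_of_lt {α k T : ℝ} {x s : ℝ → ℝ} (h : IsNormSol α k x s)
    (hk : 0 ≤ k) (hα : k < 2 * α) (hT : 0 < T) (hx : Function.Periodic x T)
    (hs : Function.Periodic s T) (t t' : ℝ) : (x t, s t) = (x t', s t') := by
  by_contra hne
  obtain ⟨t₁, t₂, t₃, ht, hmax⟩ := h.exists_isTurn_after_max hT hx hs ⟨t, t', hne⟩
  obtain ⟨h23, L, hLc, hL2, hL3, hL⟩ := h.exists_lower_graph ht
  obtain ⟨h21, U, hUc, hU2, hU1, hU⟩ := h.exists_upper_graph ht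
  have hpos := h.s_pos t₂
  have hmono : StrictMonoOn (gap α L U) (Icc (s t₂) (s t₃)) := by
    refine strictMonoOn_of_deriv_pos (convex_Icc _ _) (continuousOn_gap hLc hUc hpos)
      fun r hr => ?_
    rw [interior_Icc] at hr
    obtain ⟨-, hl1, hl2⟩ := hL r hr
    obtain ⟨hu1, hu2⟩ := hU r ⟨hr.1, hr.2.trans_le (hmax t₃)⟩
    have hr0 := hpos.trans hr.1
    rw [(hasDerivAt_gap hl2 hu2 hr0 hl1.ne hu1.ne').deriv]
    exact mul_pos (Real.rpow_pos_of_pos hr0 _) (gapRate_pos hk hα (hl1.trans hu1))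
  have h1 := hmono (left_mem_Icc.2 h23.le) (right_mem_Icc.2 h23.le) h23
  have h2 : 0 ≤ s t₃ ^ α * (U (s t₃) - 1) ^ 2 :=
    mul_nonneg (Real.rpow_nonneg (h.s_pos t₃).le _) (sq_nonneg _)
  simp only [gap, hL2, hL3, hU2, sub_self] at h1
  linarith

/-! ### Strong damping -/

/-- At x = 1 the drift is α + r - k(1 - r)⁺. The resulting lower bound 1/(1 + k) for 1 - r dictates
the size of δ in `barrier`. -/
theorem lt_of_drift_neg {α k r : ℝ} (hα : 0 < α) (hr : 0 < r)
    (h : drift α k r 1 < 0) : 1 < (1 - r) * (1 + k) := by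
  unfold drift at h
  rcases max_cases (1 - r) 0 with h' | h'
  · rw [h'.1] at h; linarith
  · rw [h'.1] at h; linarith

/-- The lower arc of a turn. -/
structure IsLowerArc (α k : ℝ) (L : ℝ → ℝ) (a b : ℝ) : Prop where
  lt : a < b
  pos : 0 < a
  cont : Continuous L
  left : L a = 1
  right : L b = 1
  pos_lt_one : ∀ r ∈ Ioo a b, 0 < L r ∧ L r < 1
  traj : ∀ r ∈ Ioo a b, IsTrajAt α k L r
  drift_neg : drift α k a 1 < 0

namespace IsLowerArc

variable {α k a b : ℝ} {L : ℝ → ℝ}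

theorem hasDerivAt_sq (h : IsLowerArc α k L a b) {r : ℝ} (hr : r ∈ Ioo a b) :
    HasDerivAt (fun r => (L r - 1) ^ 2) (-(drift α k r (L r) / r)) r :=
  (h.traj r hr).hasDerivAt_sq (h.pos.trans hr.1) (h.pos_lt_one r hr).2.ne

theorem mem_Icc (h : IsLowerArc α k L a b) {r : ℝ} (hr : r ∈ Icc a b) : L r ∈ Icc 0 1 := by
  rcases eq_or_lt_of_le hr.1 with rfl | h1
  · simp [h.left]
  rcases eq_or_lt_of_le hr.2 with rfl | h2
  · simp [h.right]
  · exact ⟨(h.pos_lt_one r ⟨h1, h2⟩).1.le, (h.pos_lt_one r ⟨h1, h2⟩).2.le⟩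

/-- The largest value of `s` on a lower arc is at most one. -/
theorem right_le_one (h : IsLowerArc α k L a b) (hα : 0 < α) (hk : 0 < k) : b ≤ 1 := by
  have ha1 : a < 1 := by
    have := lt_of_drift_neg hα h.pos h.drift_neg
    by_contra! hle
    nlinarith
  have hcont := h.cont
  have hb := nonneg_of_deriv_pos_of_zero (f := fun r => 1 - r - (L r - 1) ^ 2) (a := a) (b := b)
    (by fun_prop) (by simp [h.left, ha1]) (fun r hr h0 => by
      refine ⟨_, ?_, ((hasDerivAt_id r).const_sub 1).sub (h.hasDerivAt_sq hr)⟩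
      obtain ⟨hl0, hl1⟩ := h.pos_lt_one r hr
      have hr0 := h.pos.trans hr.1
      -- At a zero, 1 - r = (1 - L)² ≤ 1 - L, so the damping is switched off there.
      have hlr : L r ≤ r := by nlinarith
      have hd : drift α k r (L r) = α * L r ^ 2 + r := by
        simp [drift, max_eq_right (sub_nonpos.2 hlr)]
      rw [hd, add_div, div_self hr0.ne']
      have : 0 < α * L r ^ 2 / r := by positivity
      linarith) b (right_mem_Icc.2 h.lt.le)
  simpa [h.right] using hb

/-- The lower arc of a large turn stays away from `x = 1`. -/
theorem barrier (h : IsLowerArc α k L a b) (hα : 0 < α) (hk : 0 < k) {δ : ℝ}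
    (hδ : δ * (128 * (1 + k)) = 1) (hb : 1 - δ < b) :
    a < 1 / 4 ∧ ∀ r ∈ Icc (1 / 4) b, 0 ≤ r - 1 + (L r - 1) ^ 2 + δ + (1 - r) / 8 := by
  have hb1 := h.right_le_one hα hk
  have ha1 := lt_of_drift_neg hα h.pos h.drift_neg
  have hδ0 : 0 < δ := by
    by_contra! hle
    nlinarith
  have hδ128 : δ < 1 / 128 := by nlinarith
  have hkδ : k * δ < 1 / 128 := by linarith
  have hδa : 128 * δ < 1 - a := by
    have h1 : 0 < 1 + k := by linarith
    by_contra! hle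
    nlinarith
  have hcont := h.cont
  have key := nonneg_of_deriv_neg_of_zero (f := fun r => r - 1 + (L r - 1) ^ 2 + δ + (1 - r) / 8)
    (a := max a (1 / 4)) (b := b) (by fun_prop) (by simp only [h.right]; linarith)
    (fun r hr h0 => by
      have hra : a < r := (le_max_left _ _).trans_lt hr.1
      have hr4 : 1 / 4 < r := (le_max_right _ _).trans_lt hr.1
      have hr' : r ∈ Ioo a b := ⟨hra, hr.2⟩
      have hr1 : r < 1 := hr.2.trans_le hb1
      have hr0 : 0 < r := h.pos.trans hra
      obtain ⟨hl0, hl1⟩ := h.pos_lt_one r hr'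
      refine ⟨_, ?_, ((((hasDerivAt_id r).sub_const 1).add (h.hasDerivAt_sq hr')).add_const δ).add
        (((hasDerivAt_id r).const_sub 1).div_const 8)⟩
      -- At a zero, (1 - L)² = (7/8)(1 - r) - δ. If L > r, this is at most (1 - r)² ≤ (3/4)(1 - r),
      -- so 1 - r ≤ 8δ and the damping is at most 8kδ < 1/16, while r is close to 1.
      have hmain : k * max (L r - r) 0 < r / 8 + α * L r ^ 2 := by
        have hαL : 0 < α * L r ^ 2 := by positivity
        rcases max_cases (L r - r) 0 with hm | hm
        · rw [hm.1]
          have h1 : (L r - 1) ^ 2 ≤ (1 - r) ^ 2 := by nlinarith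
          have h2 : 1 - r ≤ 8 * δ := by nlinarith
          have h3 : k * (L r - r) ≤ k * (8 * δ) := by
            apply mul_le_mul_of_nonneg_left _ hk.le
            linarith
          linarith
        · rw [hm.1]; linarith
      have hd : drift α k r (L r) / r = 1 + (α * L r ^ 2 - k * max (L r - r) 0) / r := by
        unfold drift
        field_simp
        ring
      have h5 : -(1 / 8) < (α * L r ^ 2 - k * max (L r - r) 0) / r := by
        rw [lt_div_iff₀ hr0]
        linarith
      rw [hd]
      linarith)
  have ha4 : a < 1 / 4 := by
    by_contra! hle
    have := key a ⟨max_le le_rfl hle, h.lt.le⟩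
    simp only [h.left] at this
    linarith
  refine ⟨ha4, fun r hr => key r ?_⟩
  rwa [max_eq_right ha4.le]

end IsLowerArc

/-- Measuring from x = 1 separates the two arcs: the damping is linear in u, and (l - r)⁺ = (1 - r)
- min (1 - l) (1 - r). -/
theorem gapRate_eq {α k r l u : ℝ} (hr : r ≤ u) :
    gapRate α k r l u = (2 * α - k) * (u - 1) + (2 * α * (1 - l) - k * min (1 - l) (1 - r)) := by
  have h1 : max (u - r) 0 = u - r := max_eq_left (by linarith)
  have h2 : max (l - r) 0 = 1 - r - min (1 - l) (1 - r) := by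
    rcases max_cases (l - r) 0 with h | h <;> rcases min_cases (1 - l) (1 - r) with h' | h' <;>
      linarith
  rw [gapRate, h1, h2]
  ring

theorem gapRate_le {α k r l u : ℝ} (hα : 2 * α ≤ k) (hr : r ≤ 1) (hu : 1 < u) :
    gapRate α k r l u ≤ 2 * α * (1 - l) - k * min (1 - l) (1 - r) := by
  rw [gapRate_eq (hr.trans hu.le)]
  have : (2 * α - k) * (u - 1) ≤ 0 :=
    mul_nonpos_of_nonpos_of_nonneg (by linarith) (by linarith)
  linarith

/-- The upper arc of a turn. -/
structure IsUpperArc (α k : ℝ) (U : ℝ → ℝ) (a c : ℝ) : Prop where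
  lt : a < c
  cont : Continuous U
  left : U a = 1
  right : U c = 1
  one_lt : ∀ r ∈ Ioo a c, 1 < U r
  traj : ∀ r ∈ Ioo a c, IsTrajAt α k U r

/-! ### Sign of the gap under strong damping -/

namespace IsLowerArc

variable {α k a b c δ : ℝ} {L U : ℝ → ℝ}

theorem hasDerivAt_gap (hL : IsLowerArc α k L a b) (hU : IsUpperArc α k U a c) (hcb : c ≤ b)
    {r : ℝ} (hr : r ∈ Ioo a c) :
    HasDerivAt (gap α L U) (r ^ (α - 1) * gapRate α k r (L r) (U r)) r :=
  PucciPlanar.hasDerivAt_gap (hL.traj r ⟨hr.1, hr.2.trans_le hcb⟩) (hU.traj r hr)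
    (hL.pos.trans hr.1) (hL.pos_lt_one r ⟨hr.1, hr.2.trans_le hcb⟩).2.ne (hU.one_lt r hr).ne'

theorem gap_neg_of_le (hL : IsLowerArc α k L a b) (hU : IsUpperArc α k U a c) (hcb : c ≤ b)
    (hk : 0 < k) (hα0 : 0 < α) (hαk : 2 * α < k) (hδ0 : 0 < δ) (hαδ : 2 * α < k * δ) {d : ℝ}
    (hd : d ≤ c) (hdδ : d ≤ 1 - δ) (had : a < d) : gap α L U d < 0 := by
  have hanti : StrictAntiOn (gap α L U) (Icc a d) := by
    refine strictAntiOn_of_deriv_neg (convex_Icc _ _) (continuousOn_gap hL.cont hU.cont hL.pos)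
      fun r hr => ?_
    rw [interior_Icc] at hr
    have hrc : r ∈ Ioo a c := ⟨hr.1, hr.2.trans_le hd⟩
    have hle := gapRate_le (r := r) (l := L r) hαk.le (by linarith [hr.2]) (hU.one_lt r hrc)
    obtain ⟨hl0, hl1⟩ := hL.pos_lt_one r ⟨hr.1, hrc.2.trans_le hcb⟩
    rw [(hL.hasDerivAt_gap hU hcb hrc).deriv]
    refine mul_neg_of_pos_of_neg (Real.rpow_pos_of_pos (hL.pos.trans hr.1) _) (hle.trans_lt ?_)
    -- The damping beats 2α(1 - L) either proportionally, by 2α < k, or because 1 - r ≥ δ and 2α <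
    -- kδ.
    rcases min_cases (1 - L r) (1 - r) with hm | hm
    · rw [hm.1]
      have := mul_pos (sub_pos.2 hαk) (sub_pos.2 hl1)
      linarith
    · rw [hm.1]
      have h1 : k * δ < k * (1 - r) := mul_lt_mul_of_pos_left (by linarith [hr.2]) hk
      have h2 : 2 * α * (1 - L r) ≤ 2 * α := mul_le_of_le_one_right (by linarith) (by linarith)
      linarith
  have h := hanti (left_mem_Icc.2 had.le) (right_mem_Icc.2 had.le) had
  simpa [gap, hL.left, hU.left] using h

theorem gap_sub_le (hL : IsLowerArc α k L a b) (hU : IsUpperArc α k U a c) (hcb : c ≤ b)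
    {d e C : ℝ} (had : a < d) (hde : d ≤ e) (hec : e ≤ c)
    (hC : ∀ r ∈ Ioo d e, r ^ (α - 1) * gapRate α k r (L r) (U r) ≤ C) :
    gap α L U e - gap α L U d ≤ C * (e - d) := by
  have hder : ∀ r ∈ Ioo d e, _ := fun r hr =>
    hL.hasDerivAt_gap hU hcb (r := r) ⟨had.trans hr.1, hr.2.trans_le hec⟩
  refine (convex_Icc d e).image_sub_le_mul_sub_of_deriv_le
    (continuousOn_gap hL.cont hU.cont (hL.pos.trans had)) ?_ ?_ d (left_mem_Icc.2 hde) e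
    (right_mem_Icc.2 hde) hde
  · rw [interior_Icc]
    exact fun r hr => (hder r hr).differentiableAt.differentiableWithinAt
  · rw [interior_Icc]
    intro r hr
    rw [(hder r hr).deriv]
    exact hC r hr

/-- Along a large turn the gap decreases by a fixed amount while `s` is small. -/
theorem gap_half_sub_le (hL : IsLowerArc α k L a b) (hU : IsUpperArc α k U a c) (hcb : c ≤ b)
    (hk : 0 < k) (hα0 : 0 < α) (hα1 : α < 1) (hαk : 8 * α ≤ k) (ha : a < 1 / 4) (hc : 1 / 2 ≤ c)
    (hhalf : ∀ r ∈ Ioo (1 / 4 : ℝ) (1 / 2), L r ≤ 1 / 2) :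
    gap α L U (1 / 2) - gap α L U (1 / 4) ≤ -(k / 4) * (1 / 2 - 1 / 4) := by
  refine hL.gap_sub_le hU hcb ha (by norm_num) hc fun r hr => ?_
  have hrc : r ∈ Ioo a c := ⟨ha.trans hr.1, hr.2.trans_le hc⟩
  have hle := gapRate_le (α := α) (k := k) (r := r) (l := L r) (by linarith) (by linarith [hr.2])
    (hU.one_lt r hrc)
  have hl0 := (hL.pos_lt_one r ⟨hrc.1, hrc.2.trans_le hcb⟩).1
  have hl := hhalf r hr
  have hr0 := hL.pos.trans hrc.1
  have hmin : k * (1 / 2) ≤ k * min (1 - L r) (1 - r) :=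
    mul_le_mul_of_nonneg_left (le_min (by linarith) (by linarith [hr.2])) hk.le
  have hα2 : 2 * α * (1 - L r) ≤ 2 * α := mul_le_of_le_one_right (by linarith) (by linarith)
  have hrate : gapRate α k r (L r) (U r) ≤ -(k / 4) := by linarith
  have hpow : 1 ≤ r ^ (α - 1) :=
    Real.one_le_rpow_of_pos_of_le_one_of_nonpos hr0 (by linarith [hr.2]) (by linarith)
  have := mul_le_mul_of_nonneg_left hrate (zero_le_one.trans hpow)
  have := mul_le_mul_of_nonneg_right hpow (by linarith : 0 ≤ k / 4)
  linarith

/-- Beyond 1/2 the damping is discarded: the rate is at most 2α, and r^(α-1) ≤ 1/r ≤ 2. -/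
theorem gap_sub_half_le (hL : IsLowerArc α k L a b) (hU : IsUpperArc α k U a c) (hcb : c ≤ b)
    (hk : 0 < k) (hα0 : 0 < α) (hαk : 2 * α ≤ k) (hb : b ≤ 1) (ha : a < 1 / 2)
    (hc : 1 / 2 ≤ c) : gap α L U c - gap α L U (1 / 2) ≤ 4 * α * (c - 1 / 2) := by
  refine hL.gap_sub_le hU hcb ha hc le_rfl fun r hr => ?_
  have hrc : r ∈ Ioo a c := ⟨ha.trans hr.1, hr.2⟩
  have hr0 := hL.pos.trans hrc.1
  have hr1 : r ≤ 1 := by linarith [hr.2]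
  have hle := gapRate_le (r := r) (l := L r) hαk hr1 (hU.one_lt r hrc)
  obtain ⟨hl0, hl1⟩ := hL.pos_lt_one r ⟨hrc.1, hrc.2.trans_le hcb⟩
  have hmin : 0 ≤ k * min (1 - L r) (1 - r) :=
    mul_nonneg hk.le (le_min (by linarith) (by linarith))
  have hα2 : 2 * α * (1 - L r) ≤ 2 * α := mul_le_of_le_one_right (by linarith) (by linarith)
  have hrate : gapRate α k r (L r) (U r) ≤ 2 * α := by linarith
  have hpow : r ^ (α - 1) ≤ 2 := by
    have h1 : r ^ (α - 1) ≤ r ^ (-1 : ℝ) :=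
      Real.rpow_le_rpow_of_exponent_ge hr0 hr1 (by linarith)
    rw [Real.rpow_neg_one] at h1
    have h2 : r⁻¹ ≤ (1 / 2 : ℝ)⁻¹ := inv_anti₀ (by norm_num) hr.1.le
    norm_num at h2
    linarith
  have hpow0 : 0 < r ^ (α - 1) := Real.rpow_pos_of_pos hr0 _
  calc r ^ (α - 1) * gapRate α k r (L r) (U r) ≤ r ^ (α - 1) * (2 * α) :=
        mul_le_mul_of_nonneg_left hrate hpow0.le
    _ ≤ 2 * (2 * α) := mul_le_mul_of_nonneg_right hpow (by linarith)
    _ = 4 * α := by ring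

/-- Under strong damping a turn which follows a larger one cannot close. -/
theorem gap_neg (hL : IsLowerArc α k L a b) (hU : IsUpperArc α k U a c) (hcb : c ≤ b)
    (hα0 : 0 < α) (hk : 0 < k) (hα : α * (256 * (1 + k)) < k) : gap α L U c < 0 := by
  have hb := hL.right_le_one hα0 hk
  have hαk : 256 * α < k := by
    have := mul_pos hα0 hk
    linarith
  have hα1 : α < 1 := by
    by_contra! h
    have := mul_le_mul_of_nonneg_right h hk.le
    linarith
  obtain ⟨δ, hδ⟩ : ∃ δ : ℝ, δ * (128 * (1 + k)) = 1 :=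
    ⟨_, inv_mul_cancel₀ (by positivity : (128 * (1 + k)) ≠ 0)⟩
  have hδ0 : 0 < δ := by
    by_contra! hle
    have := mul_nonpos_of_nonpos_of_nonneg hle (by positivity : 0 ≤ 128 * (1 + k))
    linarith
  have hδ128 : δ < 1 / 128 := by
    have := mul_pos hδ0 hk
    linarith
  have hαδ : 2 * α < k * δ := by
    have h1 := mul_lt_mul_of_pos_right hα hδ0
    have h2 : α * (256 * (1 + k)) * δ = 2 * α * (δ * (128 * (1 + k))) := by ring
    rw [h2, hδ] at h1
    linarith
  rcases le_or_gt c (1 - δ) with hcase | hcase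
  · exact hL.gap_neg_of_le hU hcb hk hα0 (by linarith) hδ0 hαδ le_rfl hcase hU.lt
  obtain ⟨ha, hbar⟩ := hL.barrier hα0 hk hδ (hcase.trans_le hcb)
  have h1 := hL.gap_neg_of_le hU hcb hk hα0 (by linarith) hδ0 hαδ (d := 1 / 4) (by linarith)
    (by linarith) ha
  -- If L > 1/2 the barrier fails on (1/4, 1/2): it requires (1 - L)² ≥ (7/8)(1 - r) - δ > 1/4.
  have h2 := hL.gap_half_sub_le hU hcb hk hα0 hα1 (by linarith) ha (by linarith) fun r hr => by
    have h := hbar r ⟨hr.1.le, by linarith [hr.2]⟩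
    have h0 := hL.mem_Icc (r := r) ⟨(ha.trans hr.1).le, by linarith [hr.2]⟩
    by_contra! hlt
    have : (1 - L r) * (1 - L r) ≤ 1 / 2 * (1 / 2) :=
      mul_self_le_mul_self (by linarith [h0.2]) (by linarith)
    nlinarith [hr.2]
  have h3 := hL.gap_sub_half_le hU hcb hk hα0 (by linarith) hb (by linarith) (by linarith)
  have h4 : 4 * α * (c - 1 / 2) ≤ 4 * α * (1 / 2) :=
    mul_le_mul_of_nonneg_left (by linarith) (by linarith)
  linarith

end IsLowerArc

/-- When the damping is strong compared with `α` the system has no nonconstant periodic solution. -/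
theorem IsNormSol.eq_of_periodic_of_small {α k T : ℝ} {x s : ℝ → ℝ} (h : IsNormSol α k x s)
    (hα0 : 0 < α) (hk : 0 < k) (hα : α * (256 * (1 + k)) < k) (hT : 0 < T)
    (hx : Function.Periodic x T) (hs : Function.Periodic s T) (t t' : ℝ) :
    (x t, s t) = (x t', s t') := by
  by_contra hne
  obtain ⟨t₁, t₂, t₃, ht, hmax⟩ := h.exists_isTurn_before_max hT hx hs ⟨t, t', hne⟩
  obtain ⟨h23, L, hLc, hL2, hL3, hL⟩ := h.exists_lower_graph ht
  obtain ⟨h21, U, hUc, hU2, hU1, hU⟩ := h.exists_upper_graph ht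
  have hLarc : IsLowerArc α k L (s t₂) (s t₃) := ⟨h23, h.s_pos t₂, hLc, hL2, hL3,
    fun r hr => ⟨(hL r hr).1, (hL r hr).2.1⟩, fun r hr => (hL r hr).2.2, ht.drift_neg⟩
  have hUarc : IsUpperArc α k U (s t₂) (s t₁) :=
    ⟨h21, hUc, hU2, hU1, fun r hr => (hU r hr).1, fun r hr => (hU r hr).2⟩
  refine (hLarc.gap_neg hUarc (hmax t₁) hα0 hk hα).not_ge ?_
  simp only [gap, hU1, sub_self]
  have := h.s_pos t₁
  have := Real.rpow_nonneg this.le α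
  nlinarith [mul_nonneg this (sq_nonneg (L (s t₁) - 1))]

/-! ### Reduction to the normalized system -/

/-- The logarithmic derivative of the first component. -/
noncomputable def rateX (k Lam X Z : ℝ) : ℝ := X + Z / Lam - k * max (1 - Z / Lam) 0

/-- The logarithmic derivative of the second component. -/
noncomputable def rateZ (k Lam p X Z : ℝ) : ℝ := 2 - p * X - Z / Lam + k * max (1 - Z / Lam) 0

theorem fieldX_eq {lam Lam : ℝ} (hlam : 0 < lam) (hLam : 0 < Lam) (q : ℝ × ℝ) :
    fieldX lam Lam q = q.1 * rateX (Lam / lam - 1) Lam q.1 q.2 := by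
  unfold fieldX rateX dimMinus
  split_ifs with h
  · have h1 : 1 - q.2 / Lam ≤ 0 := by rw [sub_nonpos, one_le_div hLam]; exact h.le
    rw [max_eq_right h1]
    ring
  · have h1 : 0 ≤ 1 - q.2 / Lam := by rw [sub_nonneg, div_le_one hLam]; exact not_lt.1 h
    rw [max_eq_left h1]
    field_simp
    ring

theorem fieldZ_eq {lam Lam : ℝ} (hlam : 0 < lam) (hLam : 0 < Lam) (p : ℝ) (q : ℝ × ℝ) :
    fieldZ lam Lam p q = q.2 * rateZ (Lam / lam - 1) Lam p q.1 q.2 := by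
  unfold fieldZ rateZ dimMinus
  split_ifs with h
  · have h1 : 1 - q.2 / Lam ≤ 0 := by rw [sub_nonpos, one_le_div hLam]; exact h.le
    rw [max_eq_right h1]
    ring
  · have h1 : 0 ≤ 1 - q.2 / Lam := by rw [sub_nonneg, div_le_one hLam]; exact not_lt.1 h
    rw [max_eq_left h1]
    field_simp
    ring

/-- A periodic function with at most one value at its critical points is constant. -/
theorem eq_of_periodic_of_critical {f f' : ℝ → ℝ} {T c : ℝ} (hT : 0 < T)
    (hp : Function.Periodic f T) (hf : ∀ t, HasDerivAt f (f' t) t)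
    (hc : ∀ t, f' t = 0 → f t = c) (t : ℝ) : f t = c := by
  have hcont : Continuous f := continuous_iff_continuousAt.2 fun t => (hf t).continuousAt
  obtain ⟨t₀, h0⟩ := exists_forall_le_of_periodic hT hp hcont
  obtain ⟨t₁, h1⟩ := exists_forall_ge_of_periodic hT hp hcont
  have e0 := hc t₀ (IsLocalMax.hasDerivAt_eq_zero (Eventually.of_forall h0) (hf t₀))
  have e1 := hc t₁ (IsLocalMin.hasDerivAt_eq_zero (Eventually.of_forall h1) (hf t₁))
  linarith [h0 t, h1 t]

/-- A periodic solution is constant if the normalized system has only constant periodic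
solutions. -/
theorem eq_of_periodic {k Lam p T : ℝ} (hk : 0 ≤ k) (hLam : 0 < Lam) (hp : 1 < p)
    {X Z : ℝ → ℝ} (hZ0 : ∀ t, 0 ≤ Z t)
    (hX : ∀ t, HasDerivAt X (X t * rateX k Lam (X t) (Z t)) t)
    (hZ : ∀ t, HasDerivAt Z (Z t * rateZ k Lam p (X t) (Z t)) t)
    (hT : 0 < T) (hXT : Function.Periodic X T) (hZT : Function.Periodic Z T)
    (hnorm : ∀ x s : ℝ → ℝ, IsNormSol (2 / (p - 1)) k x s → Function.Periodic x T →
      Function.Periodic s T → ∀ t t', (x t, s t) = (x t', s t')) (t t' : ℝ) :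
    X t = X t' ∧ Z t = Z t' := by
  have hp1 : 0 < p - 1 := by linarith
  have hXc : Continuous X := continuous_iff_continuousAt.2 fun t => (hX t).continuousAt
  have hZc : Continuous Z := continuous_iff_continuousAt.2 fun t => (hZ t).continuousAt
  by_cases hX0 : ∃ t₀, X t₀ = 0
  · obtain ⟨t₀, h0⟩ := hX0
    have hX0 := eq_zero_of_hasDerivAt_mul (by unfold rateX; fun_prop) hX h0
    refine ⟨by rw [hX0, hX0], ?_⟩
    by_cases hZz : ∃ t₁, Z t₁ = 0
    · obtain ⟨t₁, h1⟩ := hZz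
      have hZz := eq_zero_of_hasDerivAt_mul (by unfold rateZ; fun_prop) hZ h1
      rw [hZz, hZz]
    · push Not at hZz
      -- On X = 0 the damping is nonnegative and cannot balance 1 + (1 - Z/Λ) where Z ≤ Λ, so
      -- critical points lie in Z > Λ.
      have hcrit : ∀ t, Z t * rateZ k Lam p (X t) (Z t) = 0 → Z t = 2 * Lam := by
        intro t ht
        have h1 := (mul_eq_zero.1 ht).resolve_left (hZz t)
        rw [rateZ, hX0] at h1
        rcases max_cases (1 - Z t / Lam) 0 with hm | hm
        · rw [hm.1] at h1
          have := mul_nonneg hk hm.2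
          linarith
        · rw [hm.1] at h1
          have h2 : Z t / Lam = 2 := by linarith
          rwa [div_eq_iff hLam.ne'] at h2
      rw [eq_of_periodic_of_critical hT hZT hZ hcrit t,
        eq_of_periodic_of_critical hT hZT hZ hcrit t']
  push Not at hX0
  by_cases hZz : ∃ t₁, Z t₁ = 0
  · obtain ⟨t₁, h1⟩ := hZz
    have hZz := eq_zero_of_hasDerivAt_mul (by unfold rateZ; fun_prop) hZ h1
    refine ⟨?_, by rw [hZz, hZz]⟩
    have hcrit : ∀ t, X t * rateX k Lam (X t) (Z t) = 0 → X t = k := by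
      intro t ht
      have h1 := (mul_eq_zero.1 ht).resolve_left (hX0 t)
      simp only [rateX, hZz, zero_div, sub_zero, zero_le_one, sup_of_le_left] at h1
      linarith
    rw [eq_of_periodic_of_critical hT hXT hX hcrit t, eq_of_periodic_of_critical hT hXT hX hcrit t']
  push Not at hZz
  have hZpos : ∀ t, 0 < Z t := fun t => lt_of_le_of_ne (hZ0 t) (hZz t).symm
  have hXZ : ∀ t, HasDerivAt (fun t => X t * Z t) (X t * Z t * (2 - (p - 1) * X t)) t := fun t =>
    ((hX t).mul (hZ t)).congr_deriv (by unfold rateX rateZ; ring)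
  have hXpos : ∀ t, 0 < X t := by
    -- At a maximum of XZ one has (p - 1)X = 2, which excludes a solution with X negative
    -- throughout.
    have hpos : ∃ t₀, 0 < X t₀ := by
      obtain ⟨t₀, h0⟩ := exists_forall_le_of_periodic hT (hXT.mul hZT) (hXc.mul hZc)
      refine ⟨t₀, ?_⟩
      have h1 := IsLocalMax.hasDerivAt_eq_zero (Eventually.of_forall h0) (hXZ t₀)
      have h2 := (mul_eq_zero.1 h1).resolve_left (mul_ne_zero (hX0 t₀) (hZz t₀))
      exact pos_of_mul_pos_right (by linarith : 0 < (p - 1) * X t₀) hp1.le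
    obtain ⟨t₀, h0⟩ := hpos
    intro t
    by_contra! hle
    obtain ⟨t₁, h1⟩ := mem_range_of_exists_le_of_exists_ge hXc ⟨t, hle⟩ ⟨t₀, h0.le⟩
    exact hX0 t₁ h1
  set α := 2 / (p - 1) with hα
  have hαpos : 0 < α := by positivity
  have hαp : (p - 1) * α = 2 := by rw [hα]; field_simp
  have hsol : IsNormSol α k (fun t => X t / α) (fun t => X t * Z t / (Lam * α)) := by
    refine ⟨fun t => div_pos (hXpos t) hαpos,
      fun t => div_pos (mul_pos (hXpos t) (hZpos t)) (mul_pos hLam hαpos), fun t => ?_, fun t => ?_⟩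
    · refine ((hX t).div_const α).congr_deriv ?_
      -- Since x - s = x(1 - Z/Λ) with x > 0, the switching line Z = Λ becomes s = x.
      have h1 : X t / α - X t * Z t / (Lam * α) = X t / α * (1 - Z t / Lam) := by field_simp
      have h2 : max (X t / α * (1 - Z t / Lam)) 0 = X t / α * max (1 - Z t / Lam) 0 := by
        rw [mul_max_of_nonneg _ _ (div_pos (hXpos t) hαpos).le, mul_zero]
      rw [drift, h1, h2, rateX]
      field_simp
    · refine ((hXZ t).div_const (Lam * α)).congr_deriv ?_
      have h1 : (p - 1) * X t = 2 * (X t / α) := by rw [← hαp]; field_simp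
      rw [h1]
      ring
  have h := hnorm _ _ hsol (fun t => by simp only [hXT t]) (fun t => by simp only [hXT t, hZT t]) t t'
  rw [Prod.mk.injEq, div_left_inj' hαpos.ne', div_left_inj' (mul_pos hLam hαpos).ne'] at h
  obtain ⟨h1, h2⟩ := h
  rw [h1] at h2
  exact ⟨h1, mul_left_cancel₀ (hX0 t') h2⟩

/-- There is no periodic orbit if the normalized system has only constant periodic solutions. -/
theorem not_exists_isPeriodicOrbit {lam Lam p : ℝ} (hlam : 0 < lam) (hLam : lam ≤ Lam) (hp : 1 < p)
    (hnorm : ∀ T : ℝ, 0 < T → ∀ x s : ℝ → ℝ, IsNormSol (2 / (p - 1)) (Lam / lam - 1) x s →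
      Function.Periodic x T → Function.Periodic s T → ∀ t t', (x t, s t) = (x t', s t')) :
    ¬ ∃ S : Set (ℝ × ℝ), IsPeriodicOrbit lam Lam p S := by
  rintro ⟨-, γ, hγ, ⟨T, hT, hper⟩, ⟨t, t', hne⟩, -⟩
  have hLam0 : 0 < Lam := hlam.trans_le hLam
  have hk : 0 ≤ Lam / lam - 1 := by rw [sub_nonneg, one_le_div hlam]; exact hLam
  have h := eq_of_periodic (X := fun t => (γ t).1) (Z := fun t => (γ t).2) hk hLam0 hp
    (fun t => (hγ t).1)
    (fun t => by
      rw [← fieldX_eq hlam hLam0]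
      exact hasFDerivAt_fst.comp_hasDerivAt t (hγ t).2)
    (fun t => by
      rw [← fieldZ_eq hlam hLam0]
      exact hasFDerivAt_snd.comp_hasDerivAt t (hγ t).2)
    hT (fun t => by simp only [hper t]) (fun t => by simp only [hper t]) (hnorm T hT) t t'
  exact hne (Prod.ext h.1 h.2)

end PucciPlanar

open PucciPlanar in
theorem theorem3p2 (lam Lam : ℝ) (hlam : 0 < lam) (hLam : lam ≤ Lam) :
    (∀ p : ℝ, 1 < p → (lam < Lam → p < PucciPlanar.critExp lam Lam) →
      ¬ ∃ S : Set (ℝ × ℝ), PucciPlanar.IsPeriodicOrbit lam Lam p S) ∧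
    (lam < Lam → ∃ p₀ : ℝ, max 3 (PucciPlanar.critExp lam Lam) < p₀ ∧
      ∀ p : ℝ, p₀ < p →
        ¬ ∃ S : Set (ℝ × ℝ), PucciPlanar.IsPeriodicOrbit lam Lam p S) := by
  set k := Lam / lam - 1 with hkdef
  have hk : 0 ≤ k := by rw [hkdef, sub_nonneg, one_le_div hlam]; exact hLam
  have hkpos : lam < Lam → 0 < k := fun h => by rw [hkdef, sub_pos, one_lt_div hlam]; exact h
  constructor
  · intro p hp hcrit
    have hp1 : 0 < p - 1 := by linarith
    refine not_exists_isPeriodicOrbit hlam hLam hp fun T hT x s h hx hs =>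
      h.eq_of_periodic_of_lt hk ?_ hT hx hs
    rw [← hkdef, ← mul_div_assoc, lt_div_iff₀ hp1]
    rcases hLam.eq_or_lt with heq | hlt
    · have : k = 0 := by rw [hkdef, ← heq, div_self hlam.ne', sub_self]
      rw [this]
      norm_num
    · have h1 := hcrit hlt
      have h2 : critExp lam Lam = (k + 4) / k := by
        unfold critExp dimMinus
        rw [hkdef]
        ring_nf
      rw [h2, lt_div_iff₀ (hkpos hlt)] at h1
      linarith
  · intro hlt
    have hk0 := hkpos hlt
    -- The bound 1 + 512(1 + k)/k is exactly the smallness condition 256α(1 + k) < k for α = 2/(p -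
    -- 1).
    refine ⟨max (max 3 (critExp lam Lam)) (1 + 512 * (1 + k) / k) + 1,
      (le_max_left _ _).trans_lt (lt_add_one _), fun p hp => ?_⟩
    have h1 : 1 + 512 * (1 + k) / k < p := ((le_max_right _ _).trans_lt (lt_add_one _)).trans hp
    have h2 : 0 < 512 * (1 + k) / k := by positivity
    have hp1 : 0 < p - 1 := by linarith
    refine not_exists_isPeriodicOrbit hlam hLam (by linarith) fun T hT x s h hx hs =>
      h.eq_of_periodic_of_small (by positivity) hk0 ?_ hT hx hs
    rw [← hkdef, div_mul_eq_mul_div, div_lt_iff₀ hp1]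
    have h3 : 512 * (1 + k) / k < p - 1 := by linarith
    rw [div_lt_iff₀ hk0] at h3
    linarith
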